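/- Let $d\ge 0$ and let $\Delta$ be a locally finite, face-to-face decomposition of $\mathbb{R}^d$ into convex polyhedra: a locally finite set of nonempty closed convex polyhedra (the cells of all dimensions; each a finite intersection of closed half-spaces, possibly unbounded) covering $\mathbb{R}^d$, which contains all nonempty faces of its members and in which any two members that meet do so in a common face. Let $G$ be its $1$-skeleton: its vertices are the points $v$ such that $\{v\}$ is a cell, and its edges are the $1$-dimensional cells (segments, rays, or lines). For a vertex $v$ of an edge $e$, let $\mathbf{n}(v,e)$ be the unit vector pointing from $v$ into $e$. An equilibrium stress on $G$ is an assignment of a real number $s(e)$ to each edge $e$ such that at every vertex $v$ $$\sum_{e\ni v} s(e)\,\mathbf{n}(v,e)=\mathbf{0}.$$ Suppose that a convex surface projects onto $\Delta$. That is, suppose there is a closed convex set $K\subset\mathbb{R}^d\times\mathbb{R}$ with nonempty interior such that the vertical projection $\mathbb{R}^d\times\mathbb{R}\to\mathbb{R}^d$ maps the surface $\partial K$ bijectively onto $\mathbb{R}^d$, and the cells of $\Delta$ are exactly the projections of the faces of this surface, i.e. of the nonempty proper faces of $K$ (the sets, other than $K$, of the points where some linear functional attains its maximum over $K$). Then $G$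 supports an equilibrium stress with $s(e)>0$ for every edge $e$. In other words, $G$ is an (infinite) spider web. -/

import Mathlib

/-- A convex polyhedron in `ℝ^d`, possibly unbounded: an intersection of finitely many closed
half-spaces `l x ≤ c`. -/
def IsConvexPolyhedron {d : ℕ} (C : Set (EuclideanSpace ℝ (Fin d))) : Prop :=
  ∃ H : Finset (StrongDual ℝ (EuclideanSpace ℝ (Fin d)) × ℝ),
    C = {x | ∀ h ∈ H, h.1 x ≤ h.2}

/-- A (face-to-face, locally finite) decomposition of `ℝ^d` by convex polyhedra, given by the set
of all its closed cells of all dimensions. The nonempty faces of a polyhedron (itself included) are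
its nonempty exposed subsets, i.e. the sets where some linear functional attains its maximum. -/
structure PolyhedralDecomposition (d : ℕ) where
  /-- the closed cells, of all dimensions `0, …, d` -/
  cells : Set (Set (EuclideanSpace ℝ (Fin d)))
  polyhedron : ∀ C ∈ cells, IsConvexPolyhedron C
  nonempty : ∀ C ∈ cells, C.Nonempty
  /-- every nonempty face of a cell is a cell -/
  face_mem : ∀ C ∈ cells, ∀ F, IsExposed ℝ C F → F.Nonempty → F ∈ cells
  /-- two cells that meet do so in a common face -/
  inter_face : ∀ C ∈ cells, ∀ D ∈ cells, (C ∩ D).Nonempty →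
    IsExposed ℝ C (C ∩ D) ∧ IsExposed ℝ D (C ∩ D)
  cover : ⋃₀ cells = Set.univ
  locallyFinite : LocallyFinite (fun C : cells => (C : Set (EuclideanSpace ℝ (Fin d))))

namespace PolyhedralDecomposition

variable {d : ℕ} (Δ : PolyhedralDecomposition d)

/-- The vertices of the 1-skeleton: the points that are 0-dimensional cells. -/
def vertices : Set (EuclideanSpace ℝ (Fin d)) := {v | {v} ∈ Δ.cells}

/-- The edges of the 1-skeleton: the 1-dimensional cells. An edge is a segment, a ray or a line. -/
def edges : Set (Set (EuclideanSpace ℝ (Fin d))) :=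
  {e | e ∈ Δ.cells ∧ Module.finrank ℝ (vectorSpan ℝ e) = 1}

/-- The edges that contain the point `v`. -/
def edgesAt (v : EuclideanSpace ℝ (Fin d)) : Set (Set (EuclideanSpace ℝ (Fin d))) :=
  {e | e ∈ Δ.edges ∧ v ∈ e}

theorem finite_edgesAt (v : EuclideanSpace ℝ (Fin d)) : (Δ.edgesAt v).Finite := by
  refine ((Δ.locallyFinite.point_finite v).image Subtype.val).subset ?_
  rintro e ⟨he, hv⟩
  exact ⟨⟨e, he.1⟩, hv, rfl⟩

/-- `u` is the inner unit normal to the edge `e` at its endpoint `v`: the unit vector such that `e`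
lies on the ray from `v` in the direction `u`. -/
def IsInnerUnitNormal (v : EuclideanSpace ℝ (Fin d)) (e : Set (EuclideanSpace ℝ (Fin d)))
    (u : EuclideanSpace ℝ (Fin d)) : Prop :=
  ‖u‖ = 1 ∧ ∀ x ∈ e, ∃ t : ℝ, 0 ≤ t ∧ x = v + t • u

/-- The inner unit normal of an edge at an endpoint exists and is unique. -/
theorem existsUnique_innerUnitNormal {v : EuclideanSpace ℝ (Fin d)} (hv : v ∈ Δ.vertices)
    {e : Set (EuclideanSpace ℝ (Fin d))} (he : e ∈ Δ.edgesAt v) :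
    ∃! u, IsInnerUnitNormal v e u := by
  obtain ⟨⟨hec, hdim⟩, hve⟩ := he
  have hex : ∃ x ∈ e, x ≠ v := by
    by_contra! h
    have h1 : e = {v} := Set.eq_singleton_iff_unique_mem.2 ⟨hve, h⟩
    rw [h1, vectorSpan_singleton, finrank_bot] at hdim
    exact zero_ne_one hdim
  obtain ⟨x, hx, hxv⟩ := hex
  have hx0 : x - v ≠ 0 := sub_ne_zero.2 hxv
  have hn0 : 0 < ‖x - v‖ := norm_pos_iff.2 hx0
  have hin : e ∩ {v} = {v} := Set.inter_eq_right.2 (Set.singleton_subset_iff.2 hve)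
  obtain ⟨l, hl⟩ := (hin ▸ (Δ.inter_face e hec {v} hv ⟨v, hve, rfl⟩).1) (Set.singleton_nonempty v)
  have hlv : ∀ y ∈ e, l y ≤ l v := (hl ▸ Set.mem_singleton v : v ∈ {x ∈ e | ∀ y ∈ e, l y ≤ l x}).2
  have hlx : l (x - v) < 0 := by
    rw [map_sub, sub_neg]
    refine lt_of_le_of_ne (hlv x hx) fun h => hxv ?_
    have : x ∈ ({v} : Set (EuclideanSpace ℝ (Fin d))) := by
      rw [hl]
      exact ⟨hx, fun y hy => h ▸ hlv y hy⟩
    exact this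
  have hmem : ∀ y ∈ e, y - v ∈ vectorSpan ℝ e := fun y hy => vsub_mem_vectorSpan ℝ hy hve
  refine ⟨‖x - v‖⁻¹ • (x - v), ⟨?_, fun y hy => ?_⟩, ?_⟩
  · rw [norm_smul, norm_inv, norm_norm, inv_mul_cancel₀ hn0.ne']
  · obtain ⟨c, hc⟩ := (finrank_eq_one_iff_of_nonzero'
      (⟨x - v, hmem x hx⟩ : vectorSpan ℝ e) (by simpa using hx0)).1 hdim ⟨y - v, hmem y hy⟩
    have hc' : c • (x - v) = y - v := congrArg Subtype.val hc
    have hly : c * l (x - v) ≤ 0 := by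
      rw [← smul_eq_mul, ← map_smul, hc', map_sub]
      linarith [hlv y hy]
    refine ⟨c * ‖x - v‖, mul_nonneg (by nlinarith) hn0.le, ?_⟩
    rw [smul_smul, mul_assoc, mul_inv_cancel₀ hn0.ne', mul_one, hc']
    abel
  · rintro u ⟨hu, hray⟩
    obtain ⟨t, ht, rfl⟩ := hray x hx
    have ht0 : t ≠ 0 := by
      rintro rfl
      simp at hxv
    rw [add_sub_cancel_left, norm_smul, hu, mul_one, Real.norm_of_nonneg ht, smul_smul,
      inv_mul_cancel₀ ht0, one_smul]

/-- The inner unit normal to the edge `e` at its endpoint `v`. -/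
noncomputable def innerUnitNormal (v : Δ.vertices) (e : Δ.edgesAt v) :
    EuclideanSpace ℝ (Fin d) :=
  (Δ.existsUnique_innerUnitNormal v.2 e.2).choose

noncomputable instance (v : EuclideanSpace ℝ (Fin d)) : Fintype (Δ.edgesAt v) :=
  (Δ.finite_edgesAt v).fintype

/-- An equilibrium stress on the 1-skeleton: real coefficients on the edges such that at every
vertex the inner unit normals to the edges at this vertex, weighted by the coefficients, sum up
to zero. -/
def IsEquilibriumStress (s : Δ.edges → ℝ) : Prop :=
  ∀ v : Δ.vertices, ∑ e : Δ.edgesAt v, s ⟨e, e.2.1⟩ • Δ.innerUnitNormal v e = 0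

/-- The 1-skeleton is a spider web: it supports an equilibrium stress that is strictly positive on
all edges. -/
def SkeletonIsSpiderWeb : Prop :=
  ∃ s : Δ.edges → ℝ, Δ.IsEquilibriumStress s ∧ ∀ e, 0 < s e

/-- The convex surface `frontier K`, for a closed convex set `K ⊆ ℝ^d × ℝ` with interior points,
projects vertically onto `Δ`: every vertical line meets the surface in exactly one point, and the
cells of `Δ` are exactly the projections of the faces of the surface, that is, of the nonempty
proper faces of `K`. -/
structure IsProjectionOf (K : Set (EuclideanSpace ℝ (Fin d) × ℝ)) : Prop where
  convex : Convex ℝ K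
  isClosed : IsClosed K
  interior_nonempty : (interior K).Nonempty
  bijOn : Set.BijOn Prod.fst (frontier K) Set.univ
  cells_eq : Δ.cells = {C | ∃ F, IsExposed ℝ K F ∧ F.Nonempty ∧ F ≠ K ∧ Prod.fst '' F = C}

end PolyhedralDecomposition

/-! ### Minkowski's relation and volumes of pyramids. -/

section Minkowski

open MeasureTheory Set Filter Topology
open scoped RealInnerProductSpace

variable {E : Type*} [NormedAddCommGroup E] [InnerProductSpace ℝ E] [FiniteDimensional ℝ E]
  [MeasurableSpace E] [BorelSpace E]

/-! The stress comes from the Maxwell–Cremona dual. Up to a vertical reflection `K` is the epigraph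
of a convex function `g`, and the cells of `Δ` are the nonempty sets on which `g` touches an affine
function of some slope `p` supporting it from below (`IsProjectionOf.exists_convexOn`).

At a vertex `v` the subgradients of `g` form a convex body. Up to null sets its boundary consists of
the dual cells of the edges `e` at `v`, and `e` is perpendicular to its dual cell, with outer normal
`n(v,e)`. Minkowski's relation says that facet normals weighted by facet areas sum to zero, so the
area of the dual cell of `e` serves as `s(e)`: it does not depend on the endpoint, and it is
positive because this dual cell is a facet (`exists_ball_subset_dualCell`).

Areas enter only through volumes of pyramids. With apex `q` inside the body, the pyramid over the
dual cell of `e` with height `c` has volume `s(e) * c`, where `s(e)` is the volume at height one. On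
it the gauge of the body, centred at `q`, has gradient `c⁻¹ • n(v,e)`. The product of the two is
`s(e) • n(v,e)`, so `sum_volume_smul_gauge_gradient_eq_zero` is the equilibrium at `v`. -/

theorem LipschitzWith.integral_lineDeriv_eq_zero {φ : E → ℝ} {C : NNReal} (hφ : LipschitzWith C φ)
    (hs : HasCompactSupport φ) (w : E) : ∫ x, lineDeriv ℝ φ x w = 0 := by
  -- Integration by parts against the constant `1`; the formula reverses the direction, hence `-w`.
  have h := (LipschitzWith.const (α := E) (1 : ℝ)).integral_lineDeriv_mul_eq
    (μ := volume) hφ hs (-w)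
  have h1 : ∀ x : E, lineDeriv ℝ (fun _ : E => (1 : ℝ)) x (-w) = 0 := fun x => by
    simp [lineDeriv]
  simpa [h1] using h.symm

/-- **Minkowski's relation**, in the form of pyramids: if a convex body `B` around the origin is
dissected into convex sets on each of which its gauge is linear, then the gradients of the gauge,
weighted by the volumes of the pieces, add up to zero. -/
theorem sum_volume_smul_gauge_gradient_eq_zero {ι : Type*} [Fintype ι] {B : Set E}
    (hc : Convex ℝ B) (hcl : IsClosed B) (hb : Bornology.IsBounded B) (h0 : B ∈ 𝓝 0)
    (T : ι → Set E) (a : ι → E) (hT : ∀ i, Convex ℝ (T i)) (hTB : ∀ i, T i ⊆ B)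
    (hg : ∀ i, ∀ x ∈ T i, gauge B x = ⟪a i, x⟫) (ha : Function.Injective a)
    (hcov : volume (B \ ⋃ i, T i) = 0) :
    ∑ i, (volume (T i)).toReal • a i = 0 := by
  -- A Lipschitz tent supported in `B`, with gradient `-a i` inside `T i`. Its derivatives integrate
  -- to zero, which is the claim.
  set φ : E → ℝ := fun x => max 0 (1 - gauge B x) with hφ
  obtain ⟨K, hK⟩ := hc.lipschitz_gauge h0
  have hφL : LipschitzWith K φ := by
    refine LipschitzWith.of_dist_le_mul fun x y => ?_
    have h1 := hK.dist_le_mul x y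
    rw [Real.dist_eq] at h1 ⊢
    have h2 := abs_max_sub_max_le_abs (1 - gauge B x) (1 - gauge B y) 0
    rw [max_comm, max_comm _ (0 : ℝ)] at h2
    refine h2.trans (le_trans (le_of_eq ?_) h1)
    rw [abs_sub_comm]
    congr 1
    ring
  have hout : ∀ x, x ∉ B → φ x = 0 := fun x hx => by
    have := one_le_gauge_of_notMem (hc.starConvex (mem_of_mem_nhds h0))
      (absorbent_nhds_zero h0).absorbs hx
    simp [hφ, this]
  have hφs : HasCompactSupport φ :=
    HasCompactSupport.intro (Metric.isCompact_of_isClosed_isBounded hcl hb) hout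
  have hin : ∀ i, ∀ x ∈ interior (T i), ∀ w, lineDeriv ℝ φ x w = -⟪a i, w⟫ := by
    intro i x hx w
    have he : φ =ᶠ[𝓝 x] fun y => 1 - ⟪a i, y⟫ := by
      filter_upwards [mem_interior_iff_mem_nhds.1 hx] with y hy
      have h1 : gauge B y ≤ 1 := gauge_le_one_of_mem (hTB i hy)
      simp only [hφ]
      rw [max_eq_right (by linarith), hg i y hy]
    rw [he.lineDeriv_eq]
    have hd : HasFDerivAt (fun y => 1 - ⟪a i, y⟫) (-(innerSL ℝ (a i))) x := by
      simpa using ((innerSL ℝ (a i)).hasFDerivAt (x := x)).const_sub 1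
    simpa using (hd.hasLineDerivAt w).lineDeriv
  refine ext_inner_right ℝ fun w => ?_
  have hae : (fun x => lineDeriv ℝ φ x w) =ᵐ[volume]
      fun x => ∑ i, (interior (T i)).indicator (fun _ => -⟪a i, w⟫) x := by
    have hfr : ∀ᵐ x, ∀ i, x ∉ frontier (T i) :=
      ae_all_iff.2 fun i => measure_eq_zero_iff_ae_notMem.1 ((hT i).addHaar_frontier volume)
    filter_upwards [hfr, measure_eq_zero_iff_ae_notMem.1 hcov] with x hx1 hx2
    by_cases hxB : x ∈ B
    · obtain ⟨i, hi⟩ : ∃ i, x ∈ T i := by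
        by_contra h
        exact hx2 ⟨hxB, by simpa using h⟩
      have hi' : x ∈ interior (T i) := by
        by_contra h
        exact hx1 i ⟨subset_closure hi, h⟩
      rw [Finset.sum_eq_single i, indicator_of_mem hi', hin i x hi' w]
      -- Interiors of distinct pieces are disjoint: at a common point the gradient would be both `-a
      -- i` and `-a j`.
      · intro j _ hji
        refine indicator_of_notMem (fun hj => hji (ha ?_)) _
        refine ext_inner_right ℝ fun w' => ?_
        linarith [hin i x hi' w', hin j x hj w']
      · simp
    · have he : φ =ᶠ[𝓝 x] fun _ => 0 := by
        filter_upwards [hcl.isOpen_compl.mem_nhds hxB] with y hy using hout y hy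
      rw [he.lineDeriv_eq, Finset.sum_eq_zero]
      · simp [lineDeriv]
      · intro i _
        exact indicator_of_notMem (fun h => hxB (hTB i (interior_subset h))) _
  have hint := hφL.integral_lineDeriv_eq_zero hφs w
  have hTfin : ∀ i, volume (interior (T i)) ≠ ⊤ := fun i =>
    ((measure_mono (interior_subset.trans (hTB i))).trans_lt hb.measure_lt_top).ne
  rw [integral_congr_ae hae, integral_finsetSum] at hint
  · simp_rw [integral_indicator_const _ isOpen_interior.measurableSet] at hint
    have hvol : ∀ i, volume (interior (T i)) = volume (T i) := fun i => by
      refine measure_congr ?_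
      exact interior_ae_eq_of_null_frontier ((hT i).addHaar_frontier volume)
    simp_rw [measureReal_def, hvol, smul_eq_mul, mul_neg, Finset.sum_neg_distrib,
      neg_eq_zero] at hint
    simpa [sum_inner, inner_smul_left] using hint
  · intro i _
    exact (integrable_indicator_iff isOpen_interior.measurableSet).2
      (integrableOn_const (hTfin i))

/-- The volume of a pyramid is proportional to its height. -/
theorem volume_convexHull_insert_mul {u : E} {h : ℝ} {S : Set E} (hS : ∀ p ∈ S, ⟪u, p⟫ = h)
    {q q' : E} (hq : ⟪u, q⟫ ≠ h) :
    (volume (convexHull ℝ (insert q' S))).toReal * |⟪u, q⟫ - h| =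
      (volume (convexHull ℝ (insert q S))).toReal * |⟪u, q'⟫ - h| := by
  have hq0 : ⟪u, q⟫ - h ≠ 0 := sub_ne_zero.2 hq
  set f : Module.Dual ℝ E := (⟪u, q⟫ - h)⁻¹ • (innerSL ℝ u).toLinearMap with hf
  -- `p ↦ L p + b` fixes the hyperplane `⟪u, p⟫ = h` pointwise and sends `q` to `q'`; its
  -- determinant is the ratio of the signed heights.
  set L : E →ₗ[ℝ] E := LinearMap.transvection f (q' - q) with hL
  set b : E := -((⟪u, q⟫ - h)⁻¹ * h) • (q' - q) with hb
  have hA : ∀ p, L p + b = p + ((⟪u, q⟫ - h)⁻¹ * (⟪u, p⟫ - h)) • (q' - q) := fun p => by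
    simp only [hL, hb, hf, LinearMap.transvection.apply, LinearMap.smul_apply, smul_eq_mul,
      ContinuousLinearMap.coe_coe, innerSL_apply_apply]
    module
  have himg : (fun p => L p + b) '' insert q S = insert q' S := by
    rw [image_insert_eq]
    congr 1
    · rw [hA, inv_mul_cancel₀ hq0]
      module
    · refine (image_congr fun p hp => ?_).trans (image_id S)
      rw [hA, hS p hp]
      simp
  have hdet : L.det = (⟪u, q⟫ - h)⁻¹ * (⟪u, q'⟫ - h) := by
    rw [hL, LinearMap.transvection.det]
    simp only [hf, LinearMap.smul_apply, smul_eq_mul, ContinuousLinearMap.coe_coe,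
      innerSL_apply_apply, inner_sub_right]
    field_simp
    ring
  have hhull : convexHull ℝ (insert q' S) =
      (fun x => x + b) '' (L '' convexHull ℝ (insert q S)) := by
    rw [← himg, image_image]
    exact ((L.toAffineMap + AffineMap.const ℝ E b).image_convexHull (insert q S)).symm
  rw [hhull, image_add_right, measure_preimage_add_right, Measure.addHaar_image_linearMap, hdet,
    ENNReal.toReal_mul, ENNReal.toReal_ofReal (abs_nonneg _), abs_mul, abs_inv]
  field_simp

end Minkowski

/-! ### Subgradients, contact sets and dual cells of a convex function. -/

section Subgradients

open MeasureTheory Set Filter Topology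
open scoped RealInnerProductSpace

variable {E : Type*} [NormedAddCommGroup E] [InnerProductSpace ℝ E]

/-- The subgradients of `g` at `x`. -/
def subgradients (g : E → ℝ) (x : E) : Set E := {p | ∀ y, g x + ⟪p, y - x⟫ ≤ g y}

/-- The points at which `p` is a subgradient of `g`. -/
def contactSet (g : E → ℝ) (p : E) : Set E := {x | p ∈ subgradients g x}

/-- The common subgradients of `g` at all points of `C`: the cell dual to `C`. -/
def dualCell (g : E → ℝ) (C : Set E) : Set E := {p | C ⊆ contactSet g p}

variable {g : E → ℝ}

/-- The affine function of slope `p` touching at `x` also touches at `y`; the inequality opposite to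
`h` is automatic. -/
theorem mem_subgradients_of_eq {p x y : E} (hp : p ∈ subgradients g x)
    (h : g y ≤ g x + ⟪p, y - x⟫) : p ∈ subgradients g y := by
  intro z
  have h1 := hp z
  have h2 : ⟪p, z - x⟫ = ⟪p, z - y⟫ + ⟪p, y - x⟫ := by rw [← inner_add_right]; congr 1; abel
  linarith

/-- Each subgradient inequality is tested at the other point. Hence `g` is affine with slope `p` on
`contactSet g p`. -/
theorem eq_of_mem_subgradients {p x y : E} (hx : p ∈ subgradients g x)
    (hy : p ∈ subgradients g y) : g y = g x + ⟪p, y - x⟫ := by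
  have h1 := hx y
  have h2 := hy x
  have h3 : ⟪p, x - y⟫ = -⟪p, y - x⟫ := by rw [← inner_neg_right]; congr 1; abel
  linarith

theorem convex_subgradients (g : E → ℝ) (x : E) : Convex ℝ (subgradients g x) := by
  intro p hp p' hp' a b ha hb hab y
  have h1 := mul_le_mul_of_nonneg_left (hp y) ha
  have h2 := mul_le_mul_of_nonneg_left (hp' y) hb
  simp only [inner_add_left, real_inner_smul_left]
  have h3 : a = 1 - b := by linarith
  subst h3
  linarith

theorem isClosed_subgradients (g : E → ℝ) (x : E) : IsClosed (subgradients g x) := by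
  have : subgradients g x = ⋂ y, {p | g x + ⟪p, y - x⟫ ≤ g y} := by
    ext p
    simp [subgradients]
  rw [this]
  exact isClosed_iInter fun y => isClosed_le (by fun_prop) continuous_const

theorem isClosed_contactSet (hg : Continuous g) (p : E) : IsClosed (contactSet g p) := by
  have : contactSet g p = ⋂ y, {x | g x + ⟪p, y - x⟫ ≤ g y} := by
    ext x
    simp [contactSet, subgradients]
  rw [this]
  exact isClosed_iInter fun y => isClosed_le (by fun_prop) continuous_const

theorem convex_contactSet (hg : ConvexOn ℝ univ g) (p : E) : Convex ℝ (contactSet g p) := by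
  intro x hx y hy a b ha hb hab
  refine mem_subgradients_of_eq hx ?_
  have h1 := hg.2 (mem_univ x) (mem_univ y) ha hb hab
  have h2 := eq_of_mem_subgradients hx hy
  have h3 : a • x + b • y - x = b • (y - x) := by
    rw [show a = 1 - b by linarith]
    module
  rw [h3, real_inner_smul_right]
  rw [h2, smul_eq_mul, smul_eq_mul, show a = 1 - b by linarith] at h1
  rw [show a = 1 - b by linarith]
  linarith

theorem dualCell_subset {C : Set E} {x : E} (hx : x ∈ C) : dualCell g C ⊆ subgradients g x :=
  fun _ hp => hp hx

/-- A unit step from `x` in the direction of `p` raises `g` by at least `‖p‖`, while `g` is bounded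
on the unit ball around `x`. -/
theorem isBounded_subgradients [FiniteDimensional ℝ E] (hg : Continuous g) (x : E) :
    Bornology.IsBounded (subgradients g x) := by
  obtain ⟨M, hM⟩ := (isCompact_closedBall x 1).bddAbove_image hg.continuousOn
  refine isBounded_iff_forall_norm_le.2 ⟨M - g x, fun p hp => ?_⟩
  rcases eq_or_ne p 0 with rfl | hp0
  · have : g x ≤ M := hM (mem_image_of_mem g (Metric.mem_closedBall_self zero_le_one))
    simpa using this
  · have hn : 0 < ‖p‖ := norm_pos_iff.2 hp0
    have h1 := hp (x + ‖p‖⁻¹ • p)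
    have h2 : g (x + ‖p‖⁻¹ • p) ≤ M := hM (mem_image_of_mem g (by
      simp [norm_smul, hn.ne']))
    rw [add_sub_cancel_left, real_inner_smul_right, real_inner_self_eq_norm_sq, sq,
      inv_mul_cancel_left₀ hn.ne'] at h1
    linarith

/-- If `g` is conical near `m` and a linear functional touches the restriction of `g` to `m + V`
at `m` only, then it can be perturbed. -/
theorem exists_forall_norm_lt_le_on_submodule [FiniteDimensional ℝ E] (hg : ConvexOn ℝ univ g)
    (hgc : Continuous g) {m : E}
    (hm : ∀ᶠ x in 𝓝 m, (subgradients g m ∩ subgradients g x).Nonempty) (V : Submodule ℝ E) {p : E}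
    (hp : ∀ y ∈ V, y ≠ 0 → g m + ⟪p, y⟫ < g (m + y)) :
    ∃ δ > 0, ∀ z, ‖z‖ < δ → ∀ y ∈ V, g m + ⟪p + z, y⟫ ≤ g (m + y) := by
  obtain ⟨r', hr', hball⟩ := Metric.eventually_nhds_iff.1 hm
  obtain ⟨r, hr, hrr⟩ : ∃ r > 0, r < r' := ⟨r' / 2, by linarith, by linarith⟩
  -- For `t ≤ 1` a subgradient shared by `m` and `m + y` gives the bound; for `t ≥ 1` convexity
  -- does.
  have hcone : ∀ y : E, ‖y‖ = r → ∀ t : ℝ, 0 ≤ t →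
      g m + t * (g (m + y) - g m) ≤ g (m + t • y) := by
    intro y hy t ht
    rcases le_total t 1 with ht1 | ht1
    · obtain ⟨p', h1, h2⟩ := @hball (m + y) (by simpa [dist_eq_norm, hy] using hrr)
      have h3 := eq_of_mem_subgradients h1 h2
      have h4 := h1 (m + t • y)
      rw [add_sub_cancel_left] at h3 h4
      rw [real_inner_smul_right] at h4
      rw [h3]
      linarith
    · have ht0 : 0 < t := by linarith
      have h1 := hg.2 (mem_univ m) (mem_univ (m + t • y))
        (sub_nonneg.2 (inv_le_one_of_one_le₀ ht1)) (inv_nonneg.2 ht) (sub_add_cancel 1 t⁻¹)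
      have h2 : (1 - t⁻¹) • m + t⁻¹ • (m + t • y) = m + y := by
        rw [smul_add, smul_smul, inv_mul_cancel₀ ht0.ne']
        module
      rw [h2, smul_eq_mul, smul_eq_mul] at h1
      have h3 := mul_le_mul_of_nonneg_left h1 ht
      have h4 : t * ((1 - t⁻¹) * g m + t⁻¹ * g (m + t • y)) =
          t * g m - g m + g (m + t • y) := by field_simp
      linarith
  have hcomp : IsCompact (Metric.sphere (0 : E) r ∩ V) :=
    (isCompact_sphere 0 r).inter_right V.closed_of_finiteDimensional
  -- By compactness the strict inequality leaves a gap `δ` on the sphere of radius `r` in `V`. A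
  -- perturbation of norm below `δ / r` uses up at most `δ` there, and `hcone` carries the
  -- inequality along rays.
  obtain ⟨δ, hδ, hmin⟩ : ∃ δ > 0, ∀ y ∈ Metric.sphere (0 : E) r ∩ V,
      g m + ⟪p, y⟫ + δ ≤ g (m + y) := by
    rcases (Metric.sphere (0 : E) r ∩ V).eq_empty_or_nonempty with he | hne
    · exact ⟨1, one_pos, by simp [he]⟩
    · obtain ⟨y₀, hy₀, hy₀m⟩ := hcomp.exists_isMinOn hne
        (f := fun y => g (m + y) - (g m + ⟪p, y⟫)) (by fun_prop)
      refine ⟨g (m + y₀) - (g m + ⟪p, y₀⟫), sub_pos.2 (hp y₀ hy₀.2 ?_), fun y hy => ?_⟩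
      · rintro rfl
        have := hy₀.1
        simp at this
        linarith
      · have := isMinOn_iff.1 hy₀m y hy
        linarith
  refine ⟨δ / r, by positivity, fun z hz y hy => ?_⟩
  rcases eq_or_ne y 0 with rfl | hy0
  · simp
  have hn : 0 < ‖y‖ := norm_pos_iff.2 hy0
  have hs : ‖(r / ‖y‖) • y‖ = r := by
    rw [norm_smul, Real.norm_of_nonneg (by positivity), div_mul_cancel₀ _ hn.ne']
  have h1 := hmin ((r / ‖y‖) • y) ⟨by simpa using hs, V.smul_mem _ hy⟩
  have h2 := hcone _ hs (‖y‖ / r) (by positivity)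
  have h3 : (‖y‖ / r) • (r / ‖y‖) • y = y := by
    rw [smul_smul, div_mul_div_cancel₀ hr.ne', div_self hn.ne', one_smul]
  rw [h3] at h2
  have h4 : ⟪z, y⟫ ≤ ‖y‖ / r * δ := by
    calc ⟪z, y⟫ ≤ ‖z‖ * ‖y‖ := real_inner_le_norm z y
      _ ≤ δ / r * ‖y‖ := by gcongr
      _ = ‖y‖ / r * δ := by ring
  have h5 : ‖y‖ / r * (⟪p, (r / ‖y‖) • y⟫ + δ) ≤ ‖y‖ / r * (g (m + (r / ‖y‖) • y) - g m) := by
    gcongr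
    linarith
  have h6 : ‖y‖ / r * ⟪p, (r / ‖y‖) • y⟫ = ⟪p, y⟫ := by
    rw [← real_inner_smul_right, h3]
  rw [mul_add, h6] at h5
  rw [inner_add_left]
  linarith

/-- Contact at `v` alone makes the subgradient inequality strict elsewhere, so the perturbation
lemma applies with `V = ⊤`. -/
theorem mem_interior_subgradients [FiniteDimensional ℝ E] (hg : ConvexOn ℝ univ g)
    (hgc : Continuous g) {v p : E}
    (hv : ∀ᶠ x in 𝓝 v, (subgradients g v ∩ subgradients g x).Nonempty)
    (hp : contactSet g p = {v}) : p ∈ interior (subgradients g v) := by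
  have hpv : p ∈ subgradients g v := (hp ▸ mem_singleton v : v ∈ contactSet g p)
  obtain ⟨δ, hδ, h⟩ := exists_forall_norm_lt_le_on_submodule hg hgc hv ⊤ (p := p) (by
    intro y _ hy
    by_contra! hle
    have : v + y ∈ contactSet g p := mem_subgradients_of_eq hpv (by simpa using hle)
    rw [hp] at this
    exact hy (by simpa using this))
  refine mem_interior_iff_mem_nhds.2 (Metric.mem_nhds_iff.2 ⟨δ, hδ, fun p' hp' y => ?_⟩)
  have := h (p' - p) (by simpa [dist_eq_norm] using hp') (y - v) trivial
  simpa using this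

/-- The cell dual to an edge is a neighbourhood of each of its relatively interior points in a
hyperplane perpendicular to the edge. -/
theorem exists_ball_subset_dualCell [FiniteDimensional ℝ E] (hg : ConvexOn ℝ univ g)
    (hgc : Continuous g) {m p u : E} {s : ℝ}
    (hm : ∀ᶠ x in 𝓝 m, (subgradients g m ∩ subgradients g x).Nonempty) (hs : 0 < s)
    (hu : ‖u‖ = 1) (hmp : m + s • u ∈ contactSet g p) (hmn : m - s • u ∈ contactSet g p)
    (hline : ∀ x ∈ contactSet g p, ∃ t : ℝ, x = m + t • u) :
    ∃ δ > 0, ∀ z, ⟪u, z⟫ = 0 → ‖z‖ < δ → p + z ∈ dualCell g (contactSet g p) := by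
  have huu : ⟪u, u⟫ = 1 := by rw [real_inner_self_eq_norm_sq, hu, one_pow]
  have hmm : m ∈ contactSet g p := by
    have := convex_contactSet hg p hmp hmn (a := 1 / 2) (b := 1 / 2) (by norm_num) (by norm_num)
      (by norm_num)
    convert this using 1
    module
  have hmem : ∀ y, y ∈ (innerSL ℝ u).ker ↔ ⟪u, y⟫ = 0 := fun y => by simp
  -- The contact set meets the hyperplane through `m` perpendicular to `u` only at `m`, so `p` can
  -- be perturbed on that hyperplane.
  obtain ⟨δ, hδ, h⟩ := exists_forall_norm_lt_le_on_submodule hg hgc hm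
    (innerSL ℝ u).ker (p := p) (by
    intro y hyu hy
    rw [hmem] at hyu
    by_contra! hle
    have : m + y ∈ contactSet g p := mem_subgradients_of_eq hmm (by simpa using hle)
    obtain ⟨t, ht⟩ := hline _ this
    have hyt : y = t • u := add_left_cancel ht
    rw [hyt, real_inner_smul_right, huu, mul_one] at hyu
    exact hy (by rw [hyt, hyu, zero_smul]))
  refine ⟨δ, hδ, fun z hzu hz x hx => ?_⟩
  have huz : ⟪z, u⟫ = 0 := by rw [real_inner_comm]; exact hzu
  -- From the hyperplane to a half-space: the segment from `m + (y + t • u')` to `m - s • u'`, where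
  -- `g` is known, crosses the hyperplane at `m + (s / (s + t)) • y`. Convexity transfers the
  -- inequality; `u' = u` and `u' = -u` cover both sides.
  have key : ∀ u' y : E, ∀ t : ℝ, ⟪u, y⟫ = 0 → ⟪z, u'⟫ = 0 → m - s • u' ∈ contactSet g p →
      0 ≤ t → g m + ⟪p + z, y + t • u'⟫ ≤ g (m + (y + t • u')) := by
    intro u' y t hy hzu' hu' ht
    have hst : 0 < s + t := by linarith
    have h1 := hg.2 (mem_univ (m + (y + t • u'))) (mem_univ (m - s • u'))
      (by positivity : 0 ≤ s / (s + t)) (by positivity : 0 ≤ t / (s + t)) (by field_simp)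
    have h2 : (s / (s + t)) • (m + (y + t • u')) + (t / (s + t)) • (m - s • u') =
        m + (s / (s + t)) • y := by
      have : t / (s + t) = 1 - s / (s + t) := by field_simp; ring
      have h3 : s / (s + t) * t = (1 - s / (s + t)) * s := by field_simp; ring
      rw [this]
      calc _ = m + (s / (s + t)) • y + (s / (s + t) * t - (1 - s / (s + t)) * s) • u' := by module
        _ = _ := by rw [h3, sub_self, zero_smul, add_zero]
    have h3 := h z hz ((s / (s + t)) • y) ((hmem _).2 (by rw [real_inner_smul_right, hy, mul_zero]))
    have h4 := eq_of_mem_subgradients hmm hu'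
    rw [show m - s • u' - m = -(s • u') by abel, inner_neg_right, real_inner_smul_right] at h4
    rw [h2, h4, smul_eq_mul, smul_eq_mul] at h1
    rw [real_inner_smul_right] at h3
    have h5 := mul_le_mul_of_nonneg_left (h3.trans h1) hst.le
    have h6 : (s + t) * (g m + s / (s + t) * ⟪p + z, y⟫) = (s + t) * g m + s * ⟪p + z, y⟫ := by
      field_simp
    have h7 : (s + t) * (s / (s + t) * g (m + (y + t • u')) +
        t / (s + t) * (g m + -(s * ⟪p, u'⟫))) =
        s * g (m + (y + t • u')) + t * (g m - s * ⟪p, u'⟫) := by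
      field_simp
      ring
    rw [h6, h7] at h5
    have h8 : s * (g m + ⟪p + z, y + t • u'⟫) ≤ s * g (m + (y + t • u')) := by
      rw [inner_add_right, real_inner_smul_right, inner_add_left p z u', hzu']
      linarith
    exact le_of_mul_le_mul_left h8 hs
  have hpm : p + z ∈ subgradients g m := by
    intro y'
    set t := ⟪u, y' - m⟫ with ht
    have hy : ⟪u, y' - m - t • u⟫ = 0 := by
      rw [inner_sub_right, real_inner_smul_right, huu, mul_one, sub_self]
    rcases le_total 0 t with h0 | h0
    · have := key u (y' - m - t • u) t hy huz hmn h0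
      simpa using this
    · have := key (-u) (y' - m - t • u) (-t) hy (by rw [inner_neg_right, huz, neg_zero])
        (by simpa using hmp) (by linarith)
      simpa using this
  refine mem_subgradients_of_eq hpm ?_
  obtain ⟨t, rfl⟩ := hline x hx
  have := eq_of_mem_subgradients hmm hx
  rw [this]
  simp [inner_add_left, real_inner_smul_right, huz]

variable [FiniteDimensional ℝ E] [MeasurableSpace E] [BorelSpace E]

/-- The base contains a small disc perpendicular to `u`, so base and apex affinely span the space
and the hull has interior points. Boundedness keeps the volume finite, as `toReal` sends `⊤` to `0`.
-/
theorem volume_pyramid_pos {S : Set E} (hS : Bornology.IsBounded S) {p u : E} (hu : ‖u‖ = 1)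
    {δ : ℝ} (hδ : 0 < δ) (h : ∀ z, ⟪u, z⟫ = 0 → ‖z‖ < δ → p + z ∈ S) :
    0 < (volume (convexHull ℝ (insert (p + u) S))).toReal := by
  have huu : ⟪u, u⟫ = 1 := by rw [real_inner_self_eq_norm_sq, hu, one_pow]
  have hpS : p ∈ S := by simpa using h 0 (by simp) (by simpa using hδ)
  have hsub : insert (p + u) S ⊆ convexHull ℝ (insert (p + u) S) := subset_convexHull ℝ _
  have hspan : affineSpan ℝ (convexHull ℝ (insert (p + u) S)) = ⊤ := by
    rw [affineSpan_convexHull, ← AffineSubspace.direction_eq_top_iff_of_nonempty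
      ⟨p, subset_affineSpan ℝ _ (mem_insert_of_mem _ hpS)⟩, direction_affineSpan, eq_top_iff]
    intro y _
    have hsm : ∀ x ∈ insert (p + u) S, x - p ∈ vectorSpan ℝ (insert (p + u) S) := fun x hx =>
      vsub_mem_vectorSpan ℝ hx (mem_insert_of_mem _ hpS)
    have hum : u ∈ vectorSpan ℝ (insert (p + u) S) := by
      simpa using hsm (p + u) (mem_insert _ _)
    have hperp : ∀ z, ⟪u, z⟫ = 0 → z ∈ vectorSpan ℝ (insert (p + u) S) := by
      intro z hz
      rcases eq_or_ne z 0 with rfl | hz0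
      · exact Submodule.zero_mem _
      have hn : 0 < ‖z‖ := norm_pos_iff.2 hz0
      have hc : δ / 2 / ‖z‖ ≠ 0 := by positivity
      refine (Submodule.smul_mem_iff _ hc).1 ?_
      have := hsm (p + (δ / 2 / ‖z‖) • z) (mem_insert_of_mem _ (h _ ?_ ?_))
      · simpa using this
      · rw [real_inner_smul_right, hz, mul_zero]
      · rw [norm_smul, Real.norm_of_nonneg (by positivity), div_mul_cancel₀ _ hn.ne']
        linarith
    have h1 := Submodule.add_mem _ (Submodule.smul_mem _ ⟪u, y⟫ hum)
      (hperp (y - ⟪u, y⟫ • u) (by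
        rw [inner_sub_right, real_inner_smul_right, huu, mul_one, sub_self]))
    simpa using h1
  have hint := (convex_convexHull ℝ (insert (p + u) S)).interior_nonempty_iff_affineSpan_eq_top.2
    hspan
  refine ENNReal.toReal_pos (isOpen_interior.measure_pos volume hint |>.trans_le
    (measure_mono interior_subset)).ne' ?_
  exact (isBounded_convexHull.2 (hS.insert _)).measure_lt_top.ne

theorem volume_eq_zero_of_inner_eq {d : E} (hd : d ≠ 0) {c : ℝ} {S : Set E}
    (hS : ∀ p ∈ S, ⟪d, p⟫ = c) : volume S = 0 := by
  rcases S.eq_empty_or_nonempty with rfl | ⟨q, hq⟩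
  · exact measure_empty
  refine measure_mono_null (t := (AffineSubspace.mk' q (innerSL ℝ d).ker : Set E)) ?_ ?_
  · intro p hp
    simp [AffineSubspace.mem_mk', inner_sub_right, hS p hp, hS q hq]
  · refine Measure.addHaar_affineSubspace volume _ fun h => ?_
    have h1 : q + d ∈ AffineSubspace.mk' q (innerSL ℝ d).ker := h ▸ AffineSubspace.mem_top ℝ E _
    simp [AffineSubspace.mem_mk', hd] at h1

/-- Pyramids over the dual cells of cells of dimension at least two are null sets. -/
theorem volume_convexHull_insert_dualCell_eq_zero {C : Set E} {v x y : E} (hv : v ∈ C)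
    (hx : x ∈ C) (hy : y ∈ C) (hxy : LinearIndependent ℝ ![x - v, y - v]) (q : E) :
    volume (convexHull ℝ (insert q (dualCell g C))) = 0 := by
  have hS : ∀ p ∈ dualCell g C, ∀ w ∈ C, ⟪w - v, p⟫ = g w - g v := fun p hp w hw => by
    have := eq_of_mem_subgradients (hp hv) (hp hw)
    rw [real_inner_comm]
    linarith
  obtain ⟨d, c, hd, hq, hdS⟩ : ∃ (d : E) (c : ℝ), d ≠ 0 ∧ ⟪d, q⟫ = c ∧
      ∀ p ∈ dualCell g C, ⟪d, p⟫ = c := by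
    -- The dual cell satisfies two independent linear equations, which `q` misses by `α` and `β`. A
    -- combination of them holds at `q` as well, so the pyramid lies in a hyperplane.
    set α := ⟪x - v, q⟫ - (g x - g v) with hα
    set β := ⟪y - v, q⟫ - (g y - g v) with hβ
    by_cases hα0 : α = 0
    · exact ⟨x - v, g x - g v, hxy.ne_zero 0, by linarith, fun p hp => hS p hp x hx⟩
    · refine ⟨β • (x - v) + (-α) • (y - v), _, fun h => ?_, rfl, fun p hp => ?_⟩
      · have := LinearIndependent.pair_iff.1 hxy β (-α) h
        exact hα0 (neg_eq_zero.1 this.2)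
      · rw [inner_add_left, inner_add_left]
        simp only [real_inner_smul_left]
        rw [hS p hp x hx, hS p hp y hy, show g x - g v = ⟪x - v, q⟫ - α by rw [hα]; ring,
          show g y - g v = ⟪y - v, q⟫ - β by rw [hβ]; ring]
        ring
  refine volume_eq_zero_of_inner_eq hd (c := c) ?_
  have hconv : Convex ℝ {p : E | ⟪d, p⟫ = c} := by
    exact convex_hyperplane (f := fun p : E => ⟪d, p⟫)
      ⟨fun a b => inner_add_right _ _ _, fun a b => real_inner_smul_right _ _ _⟩ c
  exact fun p hp => convexHull_min (insert_subset (t := {p : E | ⟪d, p⟫ = c}) hq hdS) hconv hp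

end Subgradients

/-! ### From convex surfaces to convex functions. -/

section Epigraph

open Set Filter Topology
open scoped RealInnerProductSpace

/-- A closed convex set with interior points whose boundary is the graph of a function is the set
of points above this graph (`σ = 1`) or below it (`σ = -1`). -/
theorem exists_mem_iff_of_bijOn_frontier {E : Type*} [NormedAddCommGroup E] [NormedSpace ℝ E]
    {K : Set (E × ℝ)} (hK : Convex ℝ K) (hcl : IsClosed K) (hne : (interior K).Nonempty)
    (hb : BijOn Prod.fst (frontier K) univ) :
    ∃ (f : E → ℝ) (σ : ℝ), σ * σ = 1 ∧ ∀ x y, (x, y) ∈ K ↔ σ * f x ≤ σ * y := by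
  have hex : ∀ x : E, ∃ y : ℝ, (x, y) ∈ frontier K := fun x => by
    obtain ⟨⟨x', y⟩, h, rfl⟩ := hb.surjOn (mem_univ x)
    exact ⟨y, h⟩
  choose f hf using hex
  have huniq : ∀ x y, (x, y) ∈ frontier K → y = f x := fun x y h =>
    congrArg Prod.snd (hb.injOn h (hf x) rfl)
  have hfK : ∀ x, (x, f x) ∈ K := fun x => hcl.frontier_subset (hf x)
  have hfi : ∀ x, (x, f x) ∉ interior K := fun x => (hf x).2
  obtain ⟨⟨x₀, y₀⟩, h₀⟩ := hne
  have hy₀ : y₀ ≠ f x₀ := fun h => hfi x₀ (h ▸ h₀)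
  obtain ⟨σ, hσ, hσ₀⟩ : ∃ σ : ℝ, σ * σ = 1 ∧ 0 < σ * (y₀ - f x₀) := by
    rcases hy₀.lt_or_gt with h | h
    · exact ⟨-1, by norm_num, by linarith⟩
    · exact ⟨1, by norm_num, by linarith⟩
  have hσ0 : σ ≠ 0 := by
    rintro rfl
    simp at hσ
  have hmem_int : ∀ x y, y ≠ f x → (x, y) ∈ K → (x, y) ∈ interior K := fun x y hy h => by
    by_contra hi
    exact hy (huniq x y ⟨subset_closure h, hi⟩)
  -- The open vertical ray over `x₀` through `(x₀, y₀)` avoids the frontier, so by connectedness it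
  -- stays in the interior.
  have hray₀ : ∀ t : ℝ, 0 < t → (x₀, f x₀ + σ * t) ∈ K := by
    have hpre : IsPreconnected ((fun t : ℝ => (x₀, f x₀ + σ * t)) '' Ioi 0) :=
      isPreconnected_Ioi.image _ (by fun_prop)
    have hstart : (x₀, y₀) ∈ (fun t : ℝ => (x₀, f x₀ + σ * t)) '' Ioi 0 := by
      refine ⟨σ * (y₀ - f x₀), hσ₀, ?_⟩
      simp only [Prod.mk.injEq, true_and]
      linear_combination (y₀ - f x₀) * hσ
    have hsub := hpre.subset_left_of_subset_union isOpen_interior hcl.isOpen_compl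
      (disjoint_compl_right.mono_left interior_subset) (by
        rintro _ ⟨t, ht, rfl⟩
        by_cases h : (x₀, f x₀ + σ * t) ∈ K
        · refine Or.inl (hmem_int _ _ (fun h' => ?_) h)
          have : σ * t = 0 := by linarith
          exact (mul_ne_zero hσ0 (ne_of_gt ht)) this
        · exact Or.inr h)
      ⟨(x₀, y₀), hstart, h₀⟩
    exact fun t ht => interior_subset (hsub (mem_image_of_mem _ (mem_Ioi.2 ht)))
  -- The vertical direction is a recession direction of `K`: `(x, y)` is averaged with weight `s`
  -- against the point of the ray at height `1 + t / s`, and `s` tends to `0`.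
  have hrec : ∀ x y, (x, y) ∈ K → ∀ t : ℝ, 0 ≤ t → (x, y + σ * t) ∈ K := by
    intro x y hxy t ht
    have hcont : Continuous fun s : ℝ =>
        ((1 - s) • x + s • x₀, (1 - s) * y + s * (f x₀ + σ) + σ * t) := by fun_prop
    have hlim : Tendsto (fun s : ℝ =>
        ((1 - s) • x + s • x₀, (1 - s) * y + s * (f x₀ + σ) + σ * t)) (𝓝[>] 0)
        (𝓝 (x, y + σ * t)) := by
      have := (hcont.tendsto 0).mono_left (nhdsWithin_le_nhds (s := Ioi 0))
      simpa using this
    refine hcl.mem_of_tendsto hlim ?_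
    filter_upwards [Ioo_mem_nhdsGT (zero_lt_one (α := ℝ))] with s hs
    have h1 := hK hxy (hray₀ (1 + t / s) (by have := hs.1; positivity)) (sub_nonneg.2 hs.2.le)
      hs.1.le (by ring)
    have hs0 := hs.1.ne'
    convert h1 using 1
    simp only [Prod.smul_mk, Prod.mk_add_mk, smul_eq_mul, Prod.mk.injEq, true_and]
    field_simp
    ring
  refine ⟨f, σ, hσ, fun x y => ⟨fun hxy => ?_, fun hle => ?_⟩⟩
  -- Otherwise `(x, f x)` lies strictly between a point of `K` and an interior point, hence is
  -- interior.
  · by_contra! hlt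
    have hint : (x, f x + σ * 1) ∈ interior K :=
      hmem_int _ _ (by simpa using hσ0) (hrec x (f x) (hfK x) 1 zero_le_one)
    have hk : 0 < σ * (f x - y) := by linarith
    refine hfi x (hK.openSegment_self_interior_subset_interior hxy hint
      ⟨1 / (1 + σ * (f x - y)), σ * (f x - y) / (1 + σ * (f x - y)), by positivity, by positivity,
        by field_simp, ?_⟩)
    simp only [Prod.smul_mk, Prod.mk_add_mk, smul_eq_mul, Prod.mk.injEq]
    constructor
    · rw [← add_smul, ← add_div, div_self (by positivity), one_smul]
    · have : (1 + σ * (f x - y)) ≠ 0 := by positivity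
      field_simp
      linear_combination (f x - y) * hσ
  · have h1 := hrec x (f x) (hfK x) (σ * (y - f x)) (by linarith)
    convert h1 using 2
    linear_combination -(y - f x) * hσ

variable {d : ℕ} {Δ : PolyhedralDecomposition d} {K : Set (EuclideanSpace ℝ (Fin d) × ℝ)}

/-- The cells of the projection of a convex surface are the linearity domains of a convex
function. -/
theorem PolyhedralDecomposition.IsProjectionOf.exists_convexOn (h : Δ.IsProjectionOf K) :
    ∃ g : EuclideanSpace ℝ (Fin d) → ℝ, ConvexOn ℝ univ g ∧
      Δ.cells = {C | C.Nonempty ∧ ∃ p, C = contactSet g p} := by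
  obtain ⟨f, σ, hσ, hfK⟩ :=
    exists_mem_iff_of_bijOn_frontier h.convex h.isClosed h.interior_nonempty h.bijOn
  set g : EuclideanSpace ℝ (Fin d) → ℝ := fun x => σ * f x with hg
  have hgK : ∀ x y, (x, y) ∈ K ↔ g x ≤ σ * y := hfK
  have hσ2 : ∀ a, σ * (σ * a) = a := fun a => by rw [← mul_assoc, hσ, one_mul]
  have hσ0 : σ ≠ 0 := by
    rintro rfl
    simp at hσ
  have hgr : ∀ x, (x, σ * g x) ∈ K := fun x => by rw [hgK, hσ2]
  refine ⟨g, ⟨convex_univ, ?_⟩, ?_⟩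
  · intro x _ y _ a b ha hb hab
    have := h.convex (hgr x) (hgr y) ha hb hab
    simp only [Prod.smul_mk, Prod.mk_add_mk] at this
    rw [hgK] at this
    refine this.trans (le_of_eq ?_)
    simp only [smul_eq_mul]
    linear_combination (a * g x + b * g y) * hσ
  · rw [h.cells_eq]
    ext C
    constructor
    · rintro ⟨F, hF, hne, hFK, rfl⟩
      refine ⟨hne.image _, ?_⟩
      obtain ⟨l, hl⟩ := hF hne
      obtain ⟨⟨x₁, y₁⟩, hz⟩ := hne
      rw [hl] at hz
      obtain ⟨b, hb⟩ : ∃ b : ℝ, b = l (0, 1) := ⟨_, rfl⟩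
      have hsplit : ∀ x y, l (x, y) = l (x, 0) + y * b := fun x y => by
        rw [hb, ← smul_eq_mul, ← map_smul, ← map_add]
        simp
      have hneg : σ * b ≤ 0 := by
        have h1 := hz.2 (x₁, y₁ + σ) (by
          have := (hgK _ _).1 hz.1
          rw [hgK, mul_add, hσ]
          linarith)
        rw [hsplit x₁ y₁, hsplit x₁ (y₁ + σ), add_mul] at h1
        linarith
      -- If `l` had no vertical component, it would be a linear functional bounded above on the
      -- whole of `ℝ^d`, hence zero, and the face would be `K`.
      have hb0 : σ * b < 0 := by
        refine hneg.lt_of_ne fun h0 => hFK ?_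
        have hb0 : b = 0 := (mul_eq_zero.1 h0).resolve_left hσ0
        have hl0 : ∀ x y, l (x, y) = l (x, 0) := fun x y => by rw [hsplit, hb0, mul_zero, add_zero]
        have hle : ∀ x, l (x, 0) ≤ l (x₁, 0) := fun x => by
          have := hz.2 _ (hgr x)
          rwa [hl0 x, hl0 x₁] at this
        have hx0 : ∀ x, l (x, 0) ≤ 0 := fun x => by
          have := hle (x₁ + x)
          rw [show ((x₁ + x, 0) : EuclideanSpace ℝ (Fin d) × ℝ) = (x₁, 0) + (x, 0) by simp,
            map_add] at this
          linarith
        have hxz : ∀ x, l (x, 0) = 0 := fun x => by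
          have h1 := hx0 (-x)
          rw [show ((-x, 0) : EuclideanSpace ℝ (Fin d) × ℝ) = -(x, 0) by simp, map_neg] at h1
          linarith [hx0 x]
        rw [hl]
        refine Subset.antisymm (fun z hz => hz.1) fun z hz => ⟨hz, fun z' _ => ?_⟩
        rw [hl0 z.1 z.2, hl0 z'.1 z'.2, hxz, hxz]
      -- Dividing by `-(σ * b) > 0` turns `l` into `⟪p, x⟫ - σ * y`, whose maximizers lie over the
      -- contact set of `p`.
      obtain ⟨p, hp⟩ : ∃ p : EuclideanSpace ℝ (Fin d), ∀ x, ⟪p, x⟫ = (-(σ * b))⁻¹ * l (x, 0) := by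
        refine ⟨(InnerProductSpace.toDual ℝ _).symm
          ((-(σ * b))⁻¹ • l.comp (ContinuousLinearMap.inl ℝ _ ℝ)), fun x => ?_⟩
        rw [InnerProductSpace.toDual_symm_apply]
        simp
      have hlp : ∀ x y, l (x, y) = (-(σ * b)) * (⟪p, x⟫ - σ * y) := fun x y => by
        have : -(σ * b) ≠ 0 := (neg_pos.2 hb0).ne'
        rw [hp, mul_sub, mul_inv_cancel_left₀ this, hsplit x y]
        linear_combination -(y * b) * hσ
      have hcmp : ∀ x y x' y', l (x', y') ≤ l (x, y) ↔ ⟪p, x'⟫ - σ * y' ≤ ⟪p, x⟫ - σ * y :=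
        fun x y x' y' => by
          rw [hlp, hlp]
          exact mul_le_mul_iff_right₀ (by linarith)
      refine ⟨p, Subset.antisymm ?_ fun x hx => ?_⟩
      · rintro _ ⟨⟨x, y⟩, hxy, rfl⟩ x'
        rw [hl] at hxy
        have h1 := (hgK _ _).1 hxy.1
        have h2 := (hcmp _ _ _ _).1 (hxy.2 _ (hgr x'))
        rw [hσ2] at h2
        simp only [inner_sub_right]
        linarith
      · refine ⟨(x, σ * g x), ?_, rfl⟩
        rw [hl]
        refine ⟨hgr x, fun ⟨x', y'⟩ h' => (hcmp _ _ _ _).2 ?_⟩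
        have h1 := (hgK _ _).1 h'
        have h2 := hx x'
        rw [inner_sub_right] at h2
        rw [hσ2]
        linarith
    · rintro ⟨⟨x₁, hx₁⟩, p, rfl⟩
      set l : StrongDual ℝ (EuclideanSpace ℝ (Fin d) × ℝ) :=
        (innerSL ℝ p).comp (ContinuousLinearMap.fst ℝ _ ℝ) -
          σ • ContinuousLinearMap.snd ℝ _ ℝ with hl
      have hlp : ∀ x y, l (x, y) = ⟪p, x⟫ - σ * y := fun x y => by simp [hl]
      have hmem : ∀ x, x ∈ contactSet g p →
          (x, σ * g x) ∈ {z ∈ K | ∀ z' ∈ K, l z' ≤ l z} := fun x hx => by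
        refine ⟨hgr x, fun ⟨x', y'⟩ h' => ?_⟩
        have h1 := (hgK _ _).1 h'
        have h2 := hx x'
        rw [inner_sub_right] at h2
        rw [hlp, hlp, hσ2]
        linarith
      refine ⟨{z ∈ K | ∀ z' ∈ K, l z' ≤ l z}, fun _ => ⟨l, rfl⟩, ⟨_, hmem x₁ hx₁⟩, fun hE => ?_, ?_⟩
      · have h1 : (x₁, σ * (g x₁ + 1)) ∈ K := by
          rw [hgK, hσ2]
          linarith
        rw [← hE] at h1
        have h2 := h1.2 _ (hgr x₁)
        rw [hlp, hlp, hσ2, hσ2] at h2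
        linarith
      · refine Subset.antisymm ?_ fun x hx => ⟨_, hmem x hx, rfl⟩
        rintro _ ⟨⟨x, y⟩, hxy, rfl⟩ x'
        have h1 := (hgK _ _).1 hxy.1
        have h2 := hxy.2 _ (hgr x')
        rw [hlp, hlp, hσ2] at h2
        simp only [inner_sub_right]
        linarith

end Epigraph

/-! ### Dissecting the body of subgradients at a vertex and assembling the stress. -/

section SpiderWeb

open MeasureTheory Set Filter Topology
open scoped RealInnerProductSpace

theorem inner_le_gauge {E : Type*} [NormedAddCommGroup E] [InnerProductSpace ℝ E] {B : Set E}
    (h0 : B ∈ 𝓝 0) {a : E} (ha : ∀ x ∈ B, ⟪a, x⟫ ≤ 1) (x : E) : ⟪a, x⟫ ≤ gauge B x := by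
  refine le_of_forall_gt_imp_ge_of_dense fun r hr => ?_
  obtain ⟨b, hb, hbr, y, hy, rfl⟩ := exists_lt_of_gauge_lt (absorbent_nhds_zero h0) hr
  have := mul_le_mul_of_nonneg_left (ha y hy) hb.le
  simp only [real_inner_smul_right]
  linarith

/-- The gauge of `B` is linear on a pyramid whose base lies in a supporting hyperplane. -/
theorem gauge_eq_inner_of_mem_pyramid {E : Type*} [NormedAddCommGroup E] [InnerProductSpace ℝ E]
    {B : Set E} (hB : Convex ℝ B) (h0 : B ∈ 𝓝 0) {a q : E} (ha : ∀ x ∈ B, ⟪a, x⟫ ≤ 1) {S : Set E}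
    (hSB : ∀ p ∈ S, p - q ∈ B) (hS : ∀ p ∈ S, ⟪a, p - q⟫ = 1) {p : E}
    (hp : p ∈ convexHull ℝ (insert q S)) : gauge B (p - q) = ⟪a, p - q⟫ := by
  refine le_antisymm ?_ (inner_le_gauge h0 ha _)
  -- A sublevel set of a sublinear minus a linear function is convex; this one contains the apex and
  -- the base.
  have hconv : Convex ℝ {y : E | gauge B (y - q) ≤ ⟪a, y - q⟫} := by
    intro x hx y hy s t hs ht hst
    have h1 : s • x + t • y - q = s • (x - q) + t • (y - q) := by
      rw [show s = 1 - t by linarith]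
      module
    rw [mem_ofPred_eq] at hx hy ⊢
    rw [h1, inner_add_right, real_inner_smul_right, real_inner_smul_right]
    refine (gauge_add_le hB (absorbent_nhds_zero h0) _ _).trans ?_
    rw [gauge_smul_of_nonneg hs, gauge_smul_of_nonneg ht, smul_eq_mul, smul_eq_mul]
    gcongr
  refine convexHull_min (insert_subset (by simp) fun y hy => ?_) hconv hp
  rw [mem_ofPred_eq, hS y hy]
  exact gauge_le_one_of_mem (hSB y hy)

namespace PolyhedralDecomposition

variable {d : ℕ} {Δ : PolyhedralDecomposition d} {g : EuclideanSpace ℝ (Fin d) → ℝ}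

theorem exists_ne_of_mem_edges {e : Set (EuclideanSpace ℝ (Fin d))} (he : e ∈ Δ.edges)
    {v : EuclideanSpace ℝ (Fin d)} (hv : v ∈ e) : ∃ x ∈ e, x ≠ v := by
  by_contra! h
  have h1 := he.2
  rw [eq_singleton_iff_unique_mem.2 ⟨hv, h⟩, vectorSpan_singleton, finrank_bot] at h1
  exact zero_ne_one h1

theorem exists_pos_of_isInnerUnitNormal {e : Set (EuclideanSpace ℝ (Fin d))} (he : e ∈ Δ.edges)
    {v n : EuclideanSpace ℝ (Fin d)} (hv : v ∈ e) (hn : IsInnerUnitNormal v e n) :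
    ∃ t : ℝ, 0 < t ∧ v + t • n ∈ e := by
  obtain ⟨x, hx, hxv⟩ := exists_ne_of_mem_edges he hv
  obtain ⟨t, ht, rfl⟩ := hn.2 x hx
  refine ⟨t, ht.lt_of_ne ?_, hx⟩
  rintro rfl
  simp at hxv

/-- The edges share an initial segment, so the functional exposing `e ∩ e'` in `e` is constant along
`n`, hence on all of `e`. Thus an edge at `v` is determined by its direction. -/
theorem subset_of_isInnerUnitNormal (hconv : ∀ C ∈ Δ.cells, Convex ℝ C)
    {v n : EuclideanSpace ℝ (Fin d)} {e e' : Set (EuclideanSpace ℝ (Fin d))} (he : e ∈ Δ.edgesAt v)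
    (he' : e' ∈ Δ.edgesAt v) (hn : IsInnerUnitNormal v e n) (hn' : IsInnerUnitNormal v e' n) :
    e ⊆ e' := by
  obtain ⟨t, ht, hte⟩ := exists_pos_of_isInnerUnitNormal he.1 he.2 hn
  obtain ⟨t', ht', hte'⟩ := exists_pos_of_isInnerUnitNormal he'.1 he'.2 hn'
  have hseg : ∀ C ∈ Δ.cells, v ∈ C → ∀ r : ℝ, v + r • n ∈ C → ∀ τ, 0 < τ → τ ≤ r →
      v + τ • n ∈ C := by
    intro C hC hv r hr τ hτ hτr
    have hr0 : 0 < r := hτ.trans_le hτr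
    have := (hconv C hC).add_smul_mem hv hr (t := τ / r) ⟨by positivity, (div_le_one hr0).2 hτr⟩
    rwa [smul_smul, div_mul_cancel₀ _ hr0.ne'] at this
  have hτ : 0 < min t t' := lt_min ht ht'
  have h1 := hseg e he.1.1 he.2 t hte _ hτ (min_le_left _ _)
  have h2 := hseg e' he'.1.1 he'.2 t' hte' _ hτ (min_le_right _ _)
  have hne : (e ∩ e').Nonempty := ⟨v, he.2, he'.2⟩
  obtain ⟨l, hl⟩ := (Δ.inter_face e he.1.1 e' he'.1.1 hne).1 hne
  have hv : v ∈ {x ∈ e | ∀ y ∈ e, l y ≤ l x} := hl ▸ ⟨he.2, he'.2⟩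
  have hw : v + min t t' • n ∈ {x ∈ e | ∀ y ∈ e, l y ≤ l x} := hl ▸ ⟨h1, h2⟩
  have hln : l n = 0 := by
    have h3 := hv.2 _ hw.1
    have h4 := hw.2 _ hv.1
    rw [map_add, map_smul, smul_eq_mul] at h3 h4
    have : min t t' * l n = 0 := by linarith
    exact (mul_eq_zero.1 this).resolve_left hτ.ne'
  intro x hx
  have hxl : l x = l v := by
    obtain ⟨r, _, rfl⟩ := hn.2 x hx
    rw [map_add, map_smul, hln, smul_zero, add_zero]
  have : x ∈ e ∩ e' := by
    rw [hl]
    exact ⟨hx, fun y hy => hxl ▸ hv.2 y hy⟩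
  exact this.2

/-- By local finiteness, a cell containing a point close to `m` contains `m`; its slope is the
common subgradient. This says that `g` is conical near `m`. -/
theorem eventually_nonempty_subgradients_inter (hg : Continuous g)
    (hcells : Δ.cells = {C | C.Nonempty ∧ ∃ p, C = contactSet g p})
    (m : EuclideanSpace ℝ (Fin d)) :
    ∀ᶠ x in 𝓝 m, (subgradients g m ∩ subgradients g x).Nonempty := by
  have hcl : ∀ C : Δ.cells, IsClosed (C : Set (EuclideanSpace ℝ (Fin d))) := by
    rintro ⟨C, hC⟩
    rw [hcells] at hC
    obtain ⟨_, p, rfl⟩ := hC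
    exact isClosed_contactSet hg p
  filter_upwards [Δ.locallyFinite.eventually_subset hcl m] with x hx
  obtain ⟨C, hC, hxC⟩ : x ∈ ⋃₀ Δ.cells := Δ.cover ▸ mem_univ x
  have hmC : m ∈ C := @hx ⟨C, hC⟩ hxC
  rw [hcells] at hC
  obtain ⟨_, p, rfl⟩ := hC
  exact ⟨p, hmC, hxC⟩

/-- An edge contains a segment around one of its points, and lies on the line of this segment. -/
theorem exists_segment_of_mem_edges
    {e : Set (EuclideanSpace ℝ (Fin d))} (he : e ∈ Δ.edges) :
    ∃ (m u : EuclideanSpace ℝ (Fin d)) (s : ℝ), 0 < s ∧ ‖u‖ = 1 ∧ m + s • u ∈ e ∧ m - s • u ∈ e ∧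
      ∀ x ∈ e, ∃ t : ℝ, x = m + t • u := by
  obtain ⟨x, hx⟩ := Δ.nonempty e he.1
  obtain ⟨y, hy, hyx⟩ := exists_ne_of_mem_edges he hx
  have hn0 : y - x ≠ 0 := sub_ne_zero.2 hyx
  have hn : 0 < ‖y - x‖ := norm_pos_iff.2 hn0
  have hsu : (‖y - x‖ / 2) • ‖y - x‖⁻¹ • (y - x) = (1 / 2 : ℝ) • (y - x) := by
    rw [smul_smul]
    congr 1
    field_simp
  refine ⟨(1 / 2 : ℝ) • (x + y), ‖y - x‖⁻¹ • (y - x), ‖y - x‖ / 2, by positivity, ?_, ?_, ?_,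
    fun z hz => ?_⟩
  · rw [norm_smul, norm_inv, norm_norm, inv_mul_cancel₀ hn.ne']
  · rw [hsu]
    convert hy using 1
    module
  · rw [hsu]
    convert hx using 1
    module
  · obtain ⟨c, hc⟩ := (finrank_eq_one_iff_of_nonzero'
      (⟨y - x, vsub_mem_vectorSpan ℝ hy hx⟩ : vectorSpan ℝ e) (by simpa using hn0)).1 he.2
      ⟨z - x, vsub_mem_vectorSpan ℝ hz hx⟩
    have hc' : c • (y - x) = z - x := congrArg Subtype.val hc
    refine ⟨(c - 1 / 2) * ‖y - x‖, ?_⟩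
    rw [smul_smul, mul_assoc, mul_inv_cancel₀ hn.ne', mul_one, sub_smul, hc']
    module

/-- The cells at a vertex that are not edges have two linearly independent directions. -/
theorem exists_linearIndependent_of_notMem_edges {C : Set (EuclideanSpace ℝ (Fin d))}
    (hC : C ∈ Δ.cells) (he : C ∉ Δ.edges) {v : EuclideanSpace ℝ (Fin d)} (hv : v ∈ C)
    (hne : C ≠ {v}) : ∃ x ∈ C, ∃ y ∈ C, LinearIndependent ℝ ![x - v, y - v] := by
  obtain ⟨x, hx, hxv⟩ : ∃ x ∈ C, x ≠ v := by
    by_contra! h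
    exact hne (eq_singleton_iff_unique_mem.2 ⟨hv, h⟩)
  have hx0 : x - v ≠ 0 := sub_ne_zero.2 hxv
  refine ⟨x, hx, ?_⟩
  by_contra! h
  refine he ⟨hC, ?_⟩
  have hspan : vectorSpan ℝ C = Submodule.span ℝ {x - v} := by
    rw [vectorSpan_eq_span_vsub_set_right ℝ hv]
    refine le_antisymm (Submodule.span_le.2 ?_) (Submodule.span_mono ?_)
    · rintro _ ⟨y, hy, rfl⟩
      have := h y hy
      rw [LinearIndependent.pair_iff' hx0] at this
      push Not at this
      exact Submodule.mem_span_singleton.2 this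
    · rintro _ rfl
      exact ⟨x, hx, rfl⟩
  rw [hspan, finrank_span_singleton hx0]

/-- The stress of an edge: the volume of the pyramid of height one over its dual cell. -/
theorem exists_pos_forall_volume_pyramid_eq (hg : ConvexOn ℝ univ g) (hgc : Continuous g)
    (hcells : Δ.cells = {C | C.Nonempty ∧ ∃ p, C = contactSet g p})
    {e : Set (EuclideanSpace ℝ (Fin d))} (he : e ∈ Δ.edges) :
    ∃ s : ℝ, 0 < s ∧ ∀ v ∈ e, ∀ n, IsInnerUnitNormal v e n → ∀ q ∈ interior (subgradients g v),
      ∃ c : ℝ, 0 < c ∧ (volume (convexHull ℝ (insert q (dualCell g e)))).toReal = s * c ∧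
        (∀ p ∈ dualCell g e, ⟪n, p - q⟫ = c) ∧ ∀ p ∈ subgradients g v, ⟪n, p - q⟫ ≤ c := by
  obtain ⟨m, u, r, hr, hu, hmp, hmn, hline⟩ := exists_segment_of_mem_edges he
  have heC := he.1
  rw [hcells] at heC
  obtain ⟨-, p, hep⟩ := heC
  have huu : ⟪u, u⟫ = 1 := by rw [real_inner_self_eq_norm_sq, hu, one_pow]
  obtain ⟨δ, hδ, hball⟩ := exists_ball_subset_dualCell hg hgc
    (eventually_nonempty_subgradients_inter hgc hcells m) hr hu (hep ▸ hmp) (hep ▸ hmn)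
    (hep ▸ hline)
  rw [← hep] at hball
  have hSb : Bornology.IsBounded (dualCell g e) :=
    (isBounded_subgradients hgc _).subset (dualCell_subset hmp)
  have hpS : p ∈ dualCell g e := hep.subset
  -- The reference apex `p + u` is chosen before `v`, so the stress depends on the edge alone.
  refine ⟨_, volume_pyramid_pos hSb hu hδ hball, fun v hv n hn q hq => ?_⟩
  obtain ⟨t, ht, hte⟩ := exists_pos_of_isInnerUnitNormal he hv hn
  have hS : ∀ p' ∈ dualCell g e, t * ⟪n, p'⟫ = g (v + t • n) - g v := fun p' hp' => by
    have := eq_of_mem_subgradients (hp' hv) (hp' hte)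
    rw [add_sub_cancel_left, real_inner_smul_right, real_inner_comm] at this
    linarith
  have hle : ∀ p' ∈ subgradients g v, ⟪n, p'⟫ ≤ ⟪n, p⟫ := fun p' hp' => by
    have h1 := hp' (v + t • n)
    rw [add_sub_cancel_left, real_inner_smul_right, real_inner_comm] at h1
    have h2 := hS p hpS
    exact le_of_mul_le_mul_left (by linarith) ht
  have hSn : ∀ p' ∈ dualCell g e, ⟪n, p'⟫ = ⟪n, p⟫ := fun p' hp' =>
    mul_left_cancel₀ ht.ne' ((hS p' hp').trans (hS p hpS).symm)
  have hnn : ⟪n, n⟫ = 1 := by rw [real_inner_self_eq_norm_sq, hn.1, one_pow]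
  -- `n` attains its maximum over the subgradients at `p`, and the interior point `q` can still be
  -- moved along `n`.
  have hc : 0 < ⟪n, p⟫ - ⟪n, q⟫ := by
    obtain ⟨ε, hε, hεb⟩ := Metric.mem_nhds_iff.1 (mem_interior_iff_mem_nhds.1 hq)
    have := hle (q + (ε / 2) • n) (hεb (by
      rw [Metric.mem_ball, dist_eq_norm, add_sub_cancel_left, norm_smul, hn.1,
        Real.norm_of_nonneg (by positivity)]
      linarith))
    rw [inner_add_right, real_inner_smul_right, hnn] at this
    linarith
  obtain ⟨k, hk, hku⟩ : ∃ k : ℝ, |k| = 1 ∧ u = k • n := by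
    obtain ⟨t₁, -, h₁⟩ := hn.2 _ hmp
    obtain ⟨t₂, -, h₂⟩ := hn.2 _ hmn
    have h3 : (2 * r) • u = (t₁ - t₂) • n := by
      calc (2 * r) • u = (m + r • u) - (m - r • u) := by module
        _ = (t₁ - t₂) • n := by rw [h₁, h₂]; module
    have h4 : u = ((2 * r)⁻¹ * (t₁ - t₂)) • n := by
      rw [mul_smul, ← h3, inv_smul_smul₀ (by positivity)]
    refine ⟨_, ?_, h4⟩
    have h5 := hu
    rwa [h4, norm_smul, hn.1, mul_one, Real.norm_eq_abs] at h5
  have hun : ∀ x, ⟪u, x⟫ = k * ⟪n, x⟫ := fun x => by rw [hku, real_inner_smul_left]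
  refine ⟨⟪n, p⟫ - ⟪n, q⟫, hc, ?_, fun p' hp' => ?_, fun p' hp' => ?_⟩
  · have hSu : ∀ p' ∈ dualCell g e, ⟪u, p'⟫ = ⟪u, p⟫ := fun p' hp' => by
      rw [hun, hun, hSn p' hp']
    have hpu : ⟪u, p + u⟫ - ⟪u, p⟫ = 1 := by rw [inner_add_right, huu]; ring
    have := volume_convexHull_insert_mul hSu (q := p + u) (q' := q) (fun h => by linarith)
    rw [hpu, abs_one, mul_one, hun, hun, ← mul_sub, abs_mul, hk, one_mul, abs_sub_comm,
      abs_of_pos hc] at this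
    exact this
  · rw [inner_sub_right, hSn p' hp']
  · rw [inner_sub_right]
    linarith [hle p' hp']

theorem skeletonIsSpiderWeb_of_convexOn (hg : ConvexOn ℝ univ g)
    (hcells : Δ.cells = {C | C.Nonempty ∧ ∃ p, C = contactSet g p}) : Δ.SkeletonIsSpiderWeb := by
  have hgc : Continuous g := hg.locallyLipschitz.continuous
  have hconv : ∀ C ∈ Δ.cells, Convex ℝ C := by
    intro C hC
    rw [hcells] at hC
    obtain ⟨_, p, rfl⟩ := hC
    exact convex_contactSet hg p
  choose s hs hsv using fun e : Δ.edges =>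
    exists_pos_forall_volume_pyramid_eq hg hgc hcells e.2
  refine ⟨s, fun v => ?_, hs⟩
  have hnormal : ∀ e : Δ.edgesAt v, IsInnerUnitNormal (v : EuclideanSpace ℝ (Fin d)) e
      (Δ.innerUnitNormal v e) := fun e => (Δ.existsUnique_innerUnitNormal v.2 e.2).choose_spec.1
  rcases isEmpty_or_nonempty (Δ.edgesAt v) with hempty | ⟨⟨e₀⟩⟩
  · exact Finset.sum_eq_zero fun e _ => hempty.elim e
  -- In a nontrivial space points are null sets, which is needed for the apex.
  have hnt : Nontrivial (EuclideanSpace ℝ (Fin d)) := by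
    obtain ⟨x, -, hx⟩ := exists_ne_of_mem_edges e₀.2.1 e₀.2.2
    exact ⟨x, v, hx⟩
  obtain ⟨q, hq⟩ : ∃ q, q ∈ interior (subgradients g v) := by
    have hv : {(v : EuclideanSpace ℝ (Fin d))} ∈ Δ.cells := v.2
    rw [hcells] at hv
    obtain ⟨-, p, hp⟩ := hv
    exact ⟨p, mem_interior_subgradients hg hgc
      (eventually_nonempty_subgradients_inter hgc hcells v) hp.symm⟩
  choose c hc hcvol hcS hcle using fun e : Δ.edgesAt v =>
    hsv ⟨e, e.2.1⟩ v e.2.2 _ (hnormal e) q hq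
  -- The body of subgradients at `v`, and below the pyramids over dual cells, are translated so that
  -- the apex `q` becomes the origin.
  set B : Set (EuclideanSpace ℝ (Fin d)) := (fun x => x + q) ⁻¹' subgradients g v with hB
  set P : Set (EuclideanSpace ℝ (Fin d)) → Set (EuclideanSpace ℝ (Fin d)) := fun C =>
    (fun x => x + q) ⁻¹' convexHull ℝ (insert q (dualCell g C)) with hP
  have hBc : Convex ℝ B := (convex_subgradients g v).translate_preimage_left q
  have hBcl : IsClosed B := (isClosed_subgradients g v).preimage (by fun_prop)
  have hBb : Bornology.IsBounded B :=
    (IsometryEquiv.addRight q).isometry.antilipschitz.isBounded_preimage (isBounded_subgradients hgc v)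
  have hBint : ∀ x, x + q ∈ interior (subgradients g v) → x ∈ interior B := fun x hx =>
    preimage_interior_subset_interior_preimage (by fun_prop) hx
  have hB0 : B ∈ 𝓝 0 := mem_interior_iff_mem_nhds.1 (hBint 0 (by rwa [zero_add]))
  have hmemB : ∀ p, p - q ∈ B ↔ p ∈ subgradients g v := fun p => by simp [hB]
  have hPB : ∀ C, (v : EuclideanSpace ℝ (Fin d)) ∈ C → P C ⊆ B := fun C hvC x hx =>
    convexHull_min (insert_subset (interior_subset hq) (dualCell_subset hvC))
      (convex_subgradients g v) hx
  have hPvol : ∀ C, volume (P C) = volume (convexHull ℝ (insert q (dualCell g C))) := fun C =>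
    measure_preimage_add_right volume q _
  have key := sum_volume_smul_gauge_gradient_eq_zero hBc hBcl hBb hB0
    (fun e : Δ.edgesAt v => P e) (fun e => (c e)⁻¹ • Δ.innerUnitNormal v e)
    (fun e => (convex_convexHull ℝ _).translate_preimage_left q) (fun e => hPB e e.2.2) ?_ ?_ ?_
  · refine Eq.trans (Finset.sum_congr rfl fun e _ => ?_) key
    rw [hPvol, hcvol e, smul_smul, mul_inv_cancel_right₀ (hc e).ne']
  · intro e x hx
    have h := gauge_eq_inner_of_mem_pyramid hBc hB0 (a := (c e)⁻¹ • Δ.innerUnitNormal v e) (q := q)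
      (S := dualCell g e) ?_ ?_ ?_ hx
    · simpa using h
    · intro y hy
      have := hcle e (y + q) hy
      rw [add_sub_cancel_right] at this
      rw [real_inner_smul_left, inv_mul_le_iff₀ (hc e), mul_one]
      exact this
    · exact fun p hp => (hmemB p).2 (dualCell_subset e.2.2 hp)
    · intro p hp
      rw [real_inner_smul_left, hcS e p hp, inv_mul_cancel₀ (hc e).ne']
  · intro e e' hee
    have hn : ∀ e : Δ.edgesAt v, ‖Δ.innerUnitNormal v e‖ = 1 := fun e => (hnormal e).1
    have hcc : (c e)⁻¹ = (c e')⁻¹ := by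
      have := congrArg norm hee
      simpa only [norm_smul, hn, mul_one, norm_inv, Real.norm_of_nonneg (hc _).le] using this
    have hnn : Δ.innerUnitNormal v e = Δ.innerUnitNormal v e' := by
      simp only [hcc] at hee
      exact smul_right_injective _ (inv_ne_zero (hc e').ne') hee
    have h1 := hnormal e
    have h2 := hnormal e'
    rw [hnn] at h1
    exact Subtype.ext (Subset.antisymm (subset_of_isInnerUnitNormal hconv e.2 e'.2 h1 h2)
      (subset_of_isInnerUnitNormal hconv e'.2 e.2 h2 h1))
  -- It remains to cover the body. The cells in `N` have dimension at least two, so their pyramids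
  -- are null.
  · set N : Set (Set (EuclideanSpace ℝ (Fin d))) :=
      {C | C ∈ Δ.cells ∧ C ∉ Δ.edges ∧ (v : EuclideanSpace ℝ (Fin d)) ∈ C ∧ C ≠ {v.1}} with hN
    have hNfin : N.Finite := by
      refine ((Δ.locallyFinite.point_finite v.1).image Subtype.val).subset ?_
      rintro C ⟨hC, -, hv, -⟩
      exact ⟨⟨C, hC⟩, hv, rfl⟩
    have hNnull : volume (⋃ C ∈ N, P C) = 0 := by
      refine (measure_biUnion_null_iff hNfin.countable).2 ?_
      rintro C ⟨hC, hCe, hv, hne⟩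
      obtain ⟨x, hx, y, hy, hxy⟩ := exists_linearIndependent_of_notMem_edges hC hCe hv hne
      rw [hPvol]
      exact volume_convexHull_insert_dualCell_eq_zero hv hx hy hxy q
    refine measure_mono_null (t := {0} ∪ ⋃ C ∈ N, P C) ?_
      (measure_union_null (measure_singleton 0) hNnull)
    rintro x ⟨hxB, hxT⟩
    rcases eq_or_ne x 0 with rfl | hx0
    · exact Or.inl rfl
    right
    have hγ : 0 < gauge B x := (gauge_pos (absorbent_nhds_zero hB0)
      (NormedSpace.isVonNBounded_iff ℝ |>.2 hBb)).2 hx0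
    have hγ1 : gauge B x ≤ 1 := gauge_le_one_of_mem hxB
    -- The radial projection of `x` to the boundary. The contact set of `y + q` is a cell at `v`
    -- other than `{v}`, as otherwise `y + q` would be interior, and `x` lies in its pyramid.
    set y := (gauge B x)⁻¹ • x with hy
    have hgy : gauge B y = 1 := by
      rw [hy, gauge_smul_of_nonneg (by positivity), smul_eq_mul, inv_mul_cancel₀ hγ.ne']
    have hyB : y ∈ B := hBcl.closure_subset ((gauge_le_one_iff_mem_closure hBc hB0).1 hgy.le)
    have hyi : y + q ∉ interior (subgradients g v) := fun h =>
      ((gauge_lt_one_iff_mem_interior hBc hB0).2 (hBint y h)).ne hgy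
    have hvC : v.1 ∈ contactSet g (y + q) := hyB
    have hCcell : contactSet g (y + q) ∈ Δ.cells := by
      rw [hcells]
      exact ⟨⟨_, hvC⟩, _, rfl⟩
    have hCne : contactSet g (y + q) ≠ {v.1} := fun h => hyi (mem_interior_subgradients hg hgc
      (eventually_nonempty_subgradients_inter hgc hcells v) h)
    have hxP : x ∈ P (contactSet g (y + q)) := by
      have h1 : y + q ∈ dualCell g (contactSet g (y + q)) := Subset.rfl
      have h2 := convex_convexHull ℝ (insert q (dualCell g (contactSet g (y + q))))
        (subset_convexHull ℝ _ (mem_insert_of_mem _ h1)) (subset_convexHull ℝ _ (mem_insert _ _))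
        hγ.le (sub_nonneg.2 hγ1) (add_sub_cancel _ _)
      have h3 : gauge B x • (y + q) + (1 - gauge B x) • q = x + q := by
        rw [smul_add, hy, smul_inv_smul₀ hγ.ne']
        module
      rw [h3] at h2
      exact h2
    refine mem_iUnion₂.2 ⟨_, ⟨hCcell, fun hCe => hxT ?_, hvC, hCne⟩, hxP⟩
    exact mem_iUnion.2 ⟨⟨_, hCe, hvC⟩, hxP⟩

end PolyhedralDecomposition

end SpiderWeb

theorem corollary5p3 (d : ℕ) (Δ : PolyhedralDecomposition d)
    (hΔ : ∃ K : Set (EuclideanSpace ℝ (Fin d) × ℝ), Δ.IsProjectionOf K) :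
    Δ.SkeletonIsSpiderWeb := by
  obtain ⟨K, hK⟩ := hΔ
  obtain ⟨g, hg, hcells⟩ := hK.exists_convexOn
  exact PolyhedralDecomposition.skeletonIsSpiderWeb_of_convexOn hg hcells
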